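/- Let $n\ge 3$ and let $r$ be an integer with $2<r<n$. Let $M^n\subset\mathbb{R}^{n+1}$ be a translation hypersurface, that is, the graph $\{(x,F(x)) : x\in\Omega\}$ over an open set $\Omega\subset\mathbb{R}^n$ of a function of the form $F(x_1,\ldots,x_n)=f_1(x_1)+\cdots+f_n(x_n)$, where each $f_i$ is a smooth function of one real variable, defined on the values that the coordinate $x_i$ takes on $\Omega$. Orient $M$ by a smooth unit normal field $N$, let $A=-dN$ be its shape operator, and let $S_r=\sum_{1\le i_1<\cdots<i_r\le n}\lambda_{i_1}\cdots\lambda_{i_r}$ be the $r$-th elementary symmetric function of the principal curvatures $\lambda_1,\ldots,\lambda_n$ (the eigenvalues of $A$ counted with multiplicity); equivalently, $\det(A-\lambda I)=\sum_{k=0}^{n}(-1)^{n-k}S_k\lambda^{n-k}$. If $S_r$ is constant on $M$, then $S_r=0$ on $M$. -/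

import Mathlib

open scoped ContDiff RealInnerProductSpace

noncomputable section

namespace TranslationHypersurface

/-- Euclidean space `ℝ^m`. -/
abbrev Euc (m : ℕ) : Type := EuclideanSpace ℝ (Fin m)

/-- The parametrization `x ↦ (x₁, …, xₙ, F x)` of the graph of `F`. -/
def graphMap {n : ℕ} (F : Euc n → ℝ) (x : Euc n) : Euc (n + 1) :=
  WithLp.toLp 2 (Fin.snoc (α := fun _ => ℝ) (fun i => x i) (F x))

/-- The function `F(x₁, …, xₙ) = f₁(x₁) + ⋯ + fₙ(xₙ)`. -/
def separableSum {n : ℕ} (f : Fin n → ℝ → ℝ) (x : Euc n) : ℝ :=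
  ∑ i, f i (x i)

/-- The graph of `x ↦ f₁(x₁) + ⋯ + fₙ(xₙ)` over `Ω` is a (smooth) translation hypersurface:
`Ω` is open in `ℝⁿ` and each `fᵢ` is smooth on the set of values of the `i`-th coordinate on
`Ω`. -/
structure IsTranslationGraph {n : ℕ} (Ω : Set (Euc n)) (f : Fin n → ℝ → ℝ) : Prop where
  isOpen : IsOpen Ω
  smooth : ∀ i, ContDiffOn ℝ ∞ (f i) ((fun x : Euc n => x i) '' Ω)

/-- `N` is a smooth unit normal vector field along `ψ : Ω → ℝⁿ⁺¹`, i.e. an orientation of the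
hypersurface parametrized by `ψ`. -/
structure IsUnitNormalField {n : ℕ} (Ω : Set (Euc n)) (ψ N : Euc n → Euc (n + 1)) : Prop where
  smooth : ContDiffOn ℝ ∞ N Ω
  norm_eq_one : ∀ x ∈ Ω, ‖N x‖ = 1
  normal : ∀ x ∈ Ω, ∀ v : Euc n, ⟪N x, fderiv ℝ ψ x v⟫ = 0

open Classical in
/-- The shape operator `A_x` at `x` of the hypersurface immersed by `ψ` and oriented by `N`.
The tangent space at `x` is identified with `ℝⁿ` through the injective differential `dψ_x`, and
`A_x` is the endomorphism characterized by `dψ_x (A_x v) = - dN_x v`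
(see `exists_unique_shape` and `shapeOperator_spec`). -/
def shapeOperator {n : ℕ} (ψ N : Euc n → Euc (n + 1)) (x : Euc n) : Euc n →ₗ[ℝ] Euc n :=
  if h : ∃ A : Euc n →ₗ[ℝ] Euc n, ∀ v, fderiv ℝ ψ x (A v) = -fderiv ℝ N x v then h.choose else 0

/-- The shape operator exists and is unique for an immersion oriented by a unit normal field. -/
theorem exists_unique_shape {n : ℕ} {Ω : Set (Euc n)} (hΩ : IsOpen Ω)
    {ψ N : Euc n → Euc (n + 1)} (hN : IsUnitNormalField Ω ψ N) {x : Euc n} (hx : x ∈ Ω)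
    (hinj : Function.Injective (fderiv ℝ ψ x)) :
    ∃! A : Euc n →ₗ[ℝ] Euc n, ∀ v, fderiv ℝ ψ x (A v) = -fderiv ℝ N x v := by
  set L : Euc n →ₗ[ℝ] Euc (n + 1) := (fderiv ℝ ψ x : Euc n →ₗ[ℝ] Euc (n + 1)) with hL
  have hNx : N x ≠ 0 := by
    intro h
    have := hN.norm_eq_one x hx
    simp [h] at this
  have hle : LinearMap.range L ≤ (ℝ ∙ N x)ᗮ := by
    rintro _ ⟨v, rfl⟩
    rw [Submodule.mem_orthogonal_singleton_iff_inner_right]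
    exact hN.normal x hx v
  have hrange : LinearMap.range L = (ℝ ∙ N x)ᗮ := by
    apply Submodule.eq_of_le_of_finrank_eq hle
    rw [LinearMap.finrank_range_of_inj hinj]
    have h1 := Submodule.finrank_add_finrank_orthogonal (ℝ ∙ N x)
    rw [finrank_span_singleton hNx] at h1
    simp only [finrank_euclideanSpace, Fintype.card_fin] at h1 ⊢
    omega
  have hdiff : DifferentiableAt ℝ N x :=
    (hN.smooth.contDiffAt (hΩ.mem_nhds hx)).differentiableAt (by simp)
  have horth : ∀ v, ⟪N x, fderiv ℝ N x v⟫ = 0 := by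
    intro v
    have h1 : HasFDerivAt (fun y => ⟪N y, N y⟫) _ x :=
      hdiff.hasFDerivAt.inner ℝ hdiff.hasFDerivAt
    have h2 : HasFDerivAt (fun y => ⟪N y, N y⟫) (0 : Euc n →L[ℝ] ℝ) x := by
      apply (hasFDerivAt_const (1 : ℝ) x).congr_of_eventuallyEq
      filter_upwards [hΩ.mem_nhds hx] with y hy
      rw [real_inner_self_eq_norm_sq, hN.norm_eq_one y hy, one_pow]
    have h3 := congrArg (fun T : Euc n →L[ℝ] ℝ => T v) (h1.unique h2)
    simp [real_inner_comm] at h3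
    rw [real_inner_comm] at h3
    simpa [real_inner_comm] using h3
  have hmem : ∀ v, -fderiv ℝ N x v ∈ LinearMap.range L := by
    intro v
    rw [hrange, Submodule.mem_orthogonal_singleton_iff_inner_right, inner_neg_right, horth, neg_zero]
  let e := LinearEquiv.ofInjective L hinj
  let D : Euc n →ₗ[ℝ] LinearMap.range L :=
    LinearMap.codRestrict _ (-(fderiv ℝ N x : Euc n →ₗ[ℝ] Euc (n + 1))) hmem
  refine ⟨e.symm.toLinearMap ∘ₗ D, fun v => ?_, fun B hB => ?_⟩
  · exact congrArg Subtype.val (e.apply_symm_apply (D v))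
  · ext1 v
    apply hinj
    rw [hB v]
    exact (congrArg Subtype.val (e.apply_symm_apply (D v))).symm

theorem shapeOperator_spec {n : ℕ} {Ω : Set (Euc n)} (hΩ : IsOpen Ω)
    {ψ N : Euc n → Euc (n + 1)} (hN : IsUnitNormalField Ω ψ N) {x : Euc n} (hx : x ∈ Ω)
    (hinj : Function.Injective (fderiv ℝ ψ x)) (v : Euc n) :
    fderiv ℝ ψ x (shapeOperator ψ N x v) = -fderiv ℝ N x v := by
  have h := (exists_unique_shape hΩ hN hx hinj).exists
  rw [shapeOperator, dif_pos h]
  exact h.choose_spec v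

/-- The curvature `S_r` at `x` (`0 ≤ r ≤ n`): the `r`-th elementary symmetric function of the
principal curvatures, i.e. of the eigenvalues of the shape operator `A`, read off from
`det (λ I - A) = ∑ₖ (-1)ᵏ Sₖ λⁿ⁻ᵏ`. -/
def Scurv {n : ℕ} (r : ℕ) (ψ N : Euc n → Euc (n + 1)) (x : Euc n) : ℝ :=
  (-1) ^ r * (shapeOperator ψ N x).charpoly.coeff (n - r)

end TranslationHypersurface

end

open scoped ContDiff RealInnerProductSpace

namespace TranslationHypersurface

open Filter Topology Finset

/-! Write `aᵢ = fᵢ''`, `uᵢ = fᵢ'`, `W² = 1 + ∑ uᵢ²`. The last component of `N` is locally `ε / W`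
with `ε = ±1`, and `Scurv_eq` turns `S_r = c` into `curvPoly r a u² = ε^r c (W²)^m`, with `m = (r +
2) / 2 > 2`. Suppose `c ≠ 0`. Some product of `r` of the `aₖ` is nonzero, so `aᵢ, aⱼ ≠ 0` for some
`i ≠ j`, and `uᵢ²`, `uⱼ²` each sweep out an interval. Let only `xᵢ` and `xⱼ` vary. For fixed `xⱼ`
the left side is affine in `(aᵢ, uᵢ²)`; two choices of `xⱼ` allow `aᵢ` to be eliminated, leaving two
translates of `y ^ m` whose combination is affine in `y = uᵢ²`. As `m > 2`,
`rpow_translates_independent` forbids this unless the coefficients of `aᵢ` vanish; then a single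
translate is affine, which is again impossible (`const_eq_zero_of_curvPoly_eq`). -/

/-! ### Algebra of the curvature polynomial -/

/-- The polynomial `∑_{|s| = r} (∏_{i ∈ s} aᵢ) (1 + ∑_{j ∉ s} yⱼ)`. For `aᵢ = fᵢ''` and
`yᵢ = fᵢ'²` it is, up to a power of the area element, the curvature `S_r` of the graph. -/
def curvPoly {n : ℕ} (r : ℕ) (a y : Fin n → ℝ) : ℝ :=
  ∑ s ∈ (univ : Finset (Fin n)).powersetCard r, (∏ i ∈ s, a i) * (1 + ∑ j ∈ sᶜ, y j)

/-- In each index, `curvPoly` is an affine function of the pair `(aᵢ, yᵢ)`. -/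
theorem curvPoly_update_affine {n : ℕ} (r : ℕ) (a y : Fin n → ℝ) (i : Fin n) :
    ∃ P Q R : ℝ, ∀ α η : ℝ,
      curvPoly r (Function.update a i α) (Function.update y i η) = P + α * Q + η * R := by
  have key : ∀ s : Finset (Fin n), ∃ P Q R : ℝ, ∀ α η : ℝ,
      (∏ k ∈ s, Function.update a i α k) * (1 + ∑ j ∈ sᶜ, Function.update y i η j) =
        P + α * Q + η * R := by
    intro s
    by_cases hi : i ∈ s
    · refine ⟨0, (∏ k ∈ s \ {i}, a k) * (1 + ∑ j ∈ sᶜ, y j), 0, fun α η => ?_⟩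
      rw [prod_update_of_mem hi, sum_update_of_notMem (by simpa using hi)]
      ring
    · refine ⟨(∏ k ∈ s, a k) * (1 + ∑ j ∈ sᶜ \ {i}, y j), 0, ∏ k ∈ s, a k, fun α η => ?_⟩
      rw [prod_update_of_notMem hi, sum_update_of_mem (by simpa using hi)]
      ring
  choose P Q R h using key
  refine ⟨∑ s ∈ univ.powersetCard r, P s, ∑ s ∈ univ.powersetCard r, Q s,
    ∑ s ∈ univ.powersetCard r, R s, fun α η => ?_⟩
  simp only [curvPoly, h, mul_sum, sum_add_distrib]

theorem exists_two_ne_zero_of_curvPoly_ne_zero {n r : ℕ} (hr : 2 ≤ r) {a y : Fin n → ℝ}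
    (h : curvPoly r a y ≠ 0) : ∃ i j, i ≠ j ∧ a i ≠ 0 ∧ a j ≠ 0 := by
  obtain ⟨s, hs, hne⟩ := exists_ne_zero_of_sum_ne_zero h
  have hprod := prod_ne_zero_iff.1 (left_ne_zero_of_mul hne)
  have hcard : 1 < #s := by rw [(mem_powersetCard.1 hs).2]; omega
  obtain ⟨i, hi, j, hj, hij⟩ := one_lt_card.1 hcard
  exact ⟨i, j, hij, hprod i hi, hprod j hj⟩

/-- The principal curvatures' elementary symmetric functions for the matrix
`t (I - u uᵀ / W²) diag(a)`, where `W² = 1 + |u|²`. -/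
theorem charpoly_coeff_rank_one_perturbation {n r : ℕ} (hr : r ≤ n) (t : ℝ) (u a : Fin n → ℝ)
    (M : Matrix (Fin n) (Fin n) ℝ)
    (hM : ∀ i j, M i j =
      t * ((if i = j then a j else 0) - u i * (u j * a j) / (1 + ∑ k, u k ^ 2))) :
    (-1) ^ r * M.charpoly.coeff (n - r) =
      t ^ r * curvPoly r a (fun i => u i ^ 2) / (1 + ∑ k, u k ^ 2) := by
  have hW : (1 + ∑ k, u k ^ 2) ≠ 0 := by positivity
  have hc := M.charpoly_coeff_eq_sum_minors r (by simpa using hr)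
  rw [Fintype.card_fin] at hc
  rw [hc, ← mul_assoc, ← mul_pow]
  simp only [mul_neg, mul_one, neg_neg, one_pow, one_mul, curvPoly, mul_sum, sum_div]
  refine sum_congr rfl fun s hs => ?_
  -- Each principal minor is rank-one perturbation times diagonal, so the matrix determinant lemma
  -- applies: `1 - ∑_{i ∈ s} uᵢ² / W²` is `(1 + ∑_{j ∉ s} uⱼ²) / W²`.
  have hfac : M.submatrix (Subtype.val : s → Fin n) (Subtype.val : s → Fin n) =
      (1 + Matrix.replicateCol Unit (fun i : s => -(u i) / (1 + ∑ k, u k ^ 2)) *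
        Matrix.replicateRow Unit (fun i : s => u i)) * Matrix.diagonal (fun i : s => t * a i) := by
    ext i j
    rw [Matrix.mul_diagonal]
    simp only [Matrix.submatrix_apply, hM, Matrix.add_apply, Matrix.one_apply,
      Matrix.mul_apply, Matrix.replicateCol_apply, Matrix.replicateRow_apply, univ_unique,
      sum_singleton, Subtype.val_inj]
    split_ifs <;> ring
  rw [hfac, Matrix.det_mul, Matrix.det_one_add_replicateCol_mul_replicateRow, Matrix.det_diagonal,
    prod_mul_distrib, prod_const, card_univ, Fintype.card_coe, (mem_powersetCard.1 hs).2,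
    prod_coe_sort s a]
  have hdot : (fun i : s => u i) ⬝ᵥ (fun i : s => -(u i) / (1 + ∑ k, u k ^ 2)) =
      -(∑ i ∈ s, u i ^ 2) / (1 + ∑ k, u k ^ 2) := by
    rw [dotProduct, ← sum_coe_sort s, ← sum_neg_distrib, sum_div]
    exact sum_congr rfl fun i _ => by ring
  have hsum := sum_add_sum_compl s fun k => u k ^ 2
  rw [← hsum] at hW
  rw [hdot, ← hsum]
  field_simp
  ring

/-! ### Real-variable lemmas and the separated equation -/

/-- One differentiation in `y`. The term `0 * y` keeps the shape of the hypothesis, so the step can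
be iterated. -/
theorem deriv_step_rpow_comb {l h T₁ T₂ α β p q m : ℝ}
    (hpos : ∀ y ∈ Set.Ioo l h, 0 < y + T₁ ∧ 0 < y + T₂)
    (heq : ∀ y ∈ Set.Ioo l h, α * (y + T₁) ^ m + β * (y + T₂) ^ m = p + q * y) :
    ∀ y ∈ Set.Ioo l h,
      (m * α) * (y + T₁) ^ (m - 1) + (m * β) * (y + T₂) ^ (m - 1) = q + 0 * y := by
  intro y hy
  obtain ⟨h1, h2⟩ := hpos y hy
  have d1 : HasDerivAt (fun y => α * (y + T₁) ^ m + β * (y + T₂) ^ m) _ y :=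
    ((((hasDerivAt_id y).add_const T₁).rpow_const (p := m) (Or.inl h1.ne')).const_mul α).add
      ((((hasDerivAt_id y).add_const T₂).rpow_const (p := m) (Or.inl h2.ne')).const_mul β)
  have d2 : HasDerivAt (fun y => p + q * y) _ y := ((hasDerivAt_id y).const_mul q).const_add p
  have d3 := d2.congr_of_eventuallyEq (f₁ := fun y => α * (y + T₁) ^ m + β * (y + T₂) ^ m) <| by
    filter_upwards [Ioo_mem_nhds hy.1 hy.2] with z hz using heq z hz
  have := d1.unique d3
  simp only [id] at this
  linarith

/-- For `m > 2` two distinct translates of the power `y ^ m` are linearly independent modulo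
affine functions. -/
theorem rpow_translates_independent {l h T₁ T₂ α β p q m : ℝ} (hlh : l < h) (hm : 2 < m)
    (hT : T₁ ≠ T₂) (hpos : ∀ y ∈ Set.Ioo l h, 0 < y + T₁ ∧ 0 < y + T₂)
    (heq : ∀ y ∈ Set.Ioo l h, α * (y + T₁) ^ m + β * (y + T₂) ^ m = p + q * y) :
    α = 0 ∧ β = 0 := by
  -- At one point, the second and third derivatives form a 2 × 2 linear system in `α`, `β` whose
  -- determinant is a nonzero multiple of `T₂ - T₁`; `m > 2` keeps the factors `m`, `m - 1`, `m - 2`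
  -- nonzero.
  have e2 := deriv_step_rpow_comb hpos (deriv_step_rpow_comb hpos heq)
  have e3 := deriv_step_rpow_comb hpos e2
  obtain ⟨y, hy⟩ := Set.nonempty_Ioo.2 hlh
  obtain ⟨h1, h2⟩ := hpos y hy
  have e2 := e2 y hy
  have e3 := e3 y hy
  have hA : (y + T₁) ^ (m - 1 - 1) = (y + T₁) ^ (m - 1 - 1 - 1) * (y + T₁) := by
    rw [← Real.rpow_add_one h1.ne']; congr 1; ring
  have hB : (y + T₂) ^ (m - 1 - 1) = (y + T₂) ^ (m - 1 - 1 - 1) * (y + T₂) := by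
    rw [← Real.rpow_add_one h2.ne']; congr 1; ring
  rw [hA, hB] at e2
  have pA := Real.rpow_pos_of_pos h1 (m - 1 - 1 - 1)
  have pB := Real.rpow_pos_of_pos h2 (m - 1 - 1 - 1)
  set A := (y + T₁) ^ (m - 1 - 1 - 1)
  set B := (y + T₂) ^ (m - 1 - 1 - 1)
  have hm0 : m ≠ 0 := by linarith
  have hm1 : m - 1 ≠ 0 := by linarith
  have hm2 : m - 1 - 1 ≠ 0 := by linarith
  have e3' : α * A + β * B = 0 := by
    have : (m - 1 - 1) * ((m - 1) * (m * (α * A + β * B))) = 0 := by linarith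
    simpa [hm0, hm1, hm2] using this
  have e2' : α * A * (y + T₁) + β * B * (y + T₂) = 0 := by
    have : (m - 1) * (m * (α * A * (y + T₁) + β * B * (y + T₂))) = 0 := by linarith
    simpa [hm0, hm1] using this
  have hβ : β * B * (T₂ - T₁) = 0 := by linear_combination e2' - (y + T₁) * e3'
  have hβ0 : β = 0 := by simpa [pB.ne', sub_ne_zero.2 hT.symm] using hβ
  refine ⟨?_, hβ0⟩
  simpa [hβ0, pA.ne'] using e3'

/-- The square of a function with nonvanishing continuous derivative at `s₀` attains an interval
of values near `s₀`. -/
theorem exists_Ioo_subset_image_sq {u a : ℝ → ℝ} {s₀ : ℝ}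
    (hu : ∀ᶠ s in 𝓝 s₀, HasDerivAt u (a s) s) (ha : ContinuousAt a s₀) (h0 : a s₀ ≠ 0)
    {U : Set ℝ} (hU : U ∈ 𝓝 s₀) :
    ∃ l h, l < h ∧ Set.Ioo l h ⊆ (fun s => u s ^ 2) '' U := by
  obtain ⟨δ, hδ, hball⟩ := Metric.eventually_nhds_iff_ball.1
    ((hu.and (ha.eventually_ne h0)).and hU)
  have hd : ∀ s ∈ Metric.ball s₀ δ, HasDerivAt (fun s => u s ^ 2) (2 * u s * a s) s := by
    intro s hs
    simpa using (hball s hs).1.1.fun_pow 2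
  have hconn : IsPreconnected ((fun s => u s ^ 2) '' Metric.ball s₀ δ) :=
    (convex_ball s₀ δ).isPreconnected.image _
      fun s hs => (hd s hs).continuousAt.continuousWithinAt
  -- The derivative `2 u a` may vanish at `s₀`, but if `u²` were constant then `u = 0` throughout
  -- the ball, forcing `a s₀ = 0`.
  have hns : ∃ s ∈ Metric.ball s₀ δ, u s ^ 2 ≠ u s₀ ^ 2 := by
    by_contra! hcon
    have hzero : ∀ s ∈ Metric.ball s₀ δ, u s = 0 := by
      intro s hs
      have h1 : HasDerivAt (fun s => u s ^ 2) 0 s := by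
        apply (hasDerivAt_const s (u s₀ ^ 2)).congr_of_eventuallyEq
        filter_upwards [Metric.isOpen_ball.mem_nhds hs] with z hz using hcon z hz
      have h2 := (hd s hs).unique h1
      simpa [(hball s hs).1.2] using h2
    have hs₀ := Metric.mem_ball_self (x := s₀) hδ
    apply h0
    refine (hball s₀ hs₀).1.1.unique ?_
    apply (hasDerivAt_const s₀ (0 : ℝ)).congr_of_eventuallyEq
    filter_upwards [Metric.isOpen_ball.mem_nhds hs₀] with z hz using hzero z hz
  obtain ⟨s, hs, hne⟩ := hns
  have hsub : (fun s => u s ^ 2) '' Metric.ball s₀ δ ⊆ (fun s => u s ^ 2) '' U :=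
    Set.image_mono fun z hz => (hball z hz).2
  have m1 : u s ^ 2 ∈ (fun s => u s ^ 2) '' Metric.ball s₀ δ := ⟨s, hs, rfl⟩
  have m2 : u s₀ ^ 2 ∈ (fun s => u s ^ 2) '' Metric.ball s₀ δ :=
    ⟨s₀, Metric.mem_ball_self hδ, rfl⟩
  rcases hne.lt_or_gt with hlt | hlt
  · exact ⟨_, _, hlt, (Set.Ioo_subset_Icc_self.trans (hconn.Icc_subset m1 m2)).trans hsub⟩
  · exact ⟨_, _, hlt, (Set.Ioo_subset_Icc_self.trans (hconn.Icc_subset m2 m1)).trans hsub⟩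

/-- The separated equation satisfied by translation hypersurfaces of constant `S_r` has no
solution with nonzero constant, because the exponent exceeds `2`. -/
theorem const_eq_zero_of_curvPoly_eq {n r : ℕ} (hr : 2 ≤ r) {m c : ℝ} (hm : 2 < m)
    {u a : Fin n → ℝ → ℝ} {x₀ : Euc n}
    (hu : ∀ i, ∀ᶠ s in 𝓝 (x₀ i), HasDerivAt (u i) (a i s) s)
    (ha : ∀ i, ContinuousAt (a i) (x₀ i))
    (heq : ∀ᶠ x : Euc n in 𝓝 x₀, curvPoly r (fun i => a i (x i)) (fun i => u i (x i) ^ 2) =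
      c * (1 + ∑ i, u i (x i) ^ 2) ^ m) : c = 0 := by
  by_contra hc
  have hne : curvPoly r (fun i => a i (x₀ i)) (fun i => u i (x₀ i) ^ 2) ≠ 0 := by
    rw [heq.self_of_nhds]
    exact mul_ne_zero hc (Real.rpow_pos_of_pos (by positivity) _).ne'
  obtain ⟨i, j, hij, hai, haj⟩ := exists_two_ne_zero_of_curvPoly_ne_zero hr hne
  let z : ℝ × ℝ → Euc n := fun q =>
    WithLp.toLp 2 (Function.update (Function.update (fun k => x₀ k) j q.2) i q.1)
  have hz : Continuous z :=
    (PiLp.continuous_toLp 2 _).comp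
      (((continuous_const (y := (x₀ : Fin n → ℝ))).update j continuous_snd).update i
        continuous_fst)
  have hz0 : z (x₀ i, x₀ j) = x₀ := by
    ext k
    simp only [z]
    rw [Function.update_eq_self j (fun k => x₀ k), Function.update_eq_self i (fun k => x₀ k)]
  have hev := (hz.continuousAt (x := (x₀ i, x₀ j))).eventually (by rw [hz0]; exact heq)
  rw [nhds_prod_eq] at hev
  obtain ⟨pU, hU, pV, hV, hUV⟩ := eventually_prod_iff.1 hev
  obtain ⟨l, h, hlh, hI⟩ := exists_Ioo_subset_image_sq (hu i) (ha i) hai hU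
  obtain ⟨l', h', hlh', hJ⟩ := exists_Ioo_subset_image_sq (hu j) (ha j) haj hV
  obtain ⟨y₁, hy₁, hy₁'⟩ := exists_between hlh'
  obtain ⟨y₂, hy₂, hy₂'⟩ := exists_between hy₁'
  obtain ⟨τ₁, hτ₁, e₁⟩ := hJ ⟨hy₁, hy₁'⟩
  obtain ⟨τ₂, hτ₂, e₂⟩ := hJ ⟨hy₁.trans hy₂, hy₂'⟩
  -- The part of `W²` from the frozen coordinates.
  set K : ℝ := 1 + ∑ k ∈ (univ \ {i}) \ {j}, u k (x₀ k) ^ 2 with hK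
  have hKpos : 0 < K := by positivity
  have hrow : ∀ τ, pV τ → ∃ P Q R : ℝ, ∀ s, pU s →
      c * (u i s ^ 2 + (K + u j τ ^ 2)) ^ m = P + a i s * Q + u i s ^ 2 * R := by
    intro τ hτ
    let w : Fin n → ℝ := Function.update (fun k => x₀ k) j τ
    obtain ⟨P, Q, R, hPQR⟩ := curvPoly_update_affine r (fun k => a k (w k))
      (fun k => u k (w k) ^ 2) i
    refine ⟨P, Q, R, fun s hs => ?_⟩
    have h1 := hUV hs hτ
    have ea : (fun k => a k (z (s, τ) k)) = Function.update (fun k => a k (w k)) i (a i s) := by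
      ext k
      rcases eq_or_ne k i with rfl | hk
      · simp [z]
      · simp [z, w, hk]
    have eu : (fun k => u k (z (s, τ) k) ^ 2) =
        Function.update (fun k => u k (w k) ^ 2) i (u i s ^ 2) := by
      ext k
      rcases eq_or_ne k i with rfl | hk
      · simp [z]
      · simp [z, w, hk]
    have ew : (fun k => u k (w k) ^ 2) =
        Function.update (fun k => u k (x₀ k) ^ 2) j (u j τ ^ 2) := by
      ext k
      rcases eq_or_ne k j with rfl | hk
      · simp [w]
      · simp [w, hk]
    have hsum : 1 + ∑ k, u k (z (s, τ) k) ^ 2 = u i s ^ 2 + (K + u j τ ^ 2) := by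
      have h2 : ∑ k, u k (z (s, τ) k) ^ 2 =
          ∑ k, Function.update (fun k => u k (w k) ^ 2) i (u i s ^ 2) k := by rw [← eu]
      rw [h2, sum_update_of_mem (mem_univ i), ew,
        sum_update_of_mem (by simpa using hij.symm), hK]
      ring
    rw [hsum, ea, eu, hPQR] at h1
    exact h1.symm
  obtain ⟨P₁, Q₁, R₁, E₁⟩ := hrow τ₁ hτ₁
  obtain ⟨P₂, Q₂, R₂, E₂⟩ := hrow τ₂ hτ₂
  have hT : K + u j τ₁ ^ 2 ≠ K + u j τ₂ ^ 2 := by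
    simp only at e₁ e₂
    rw [e₁, e₂]
    intro h; linarith
  have hpos : ∀ y ∈ Set.Ioo l h, 0 < y + (K + u j τ₁ ^ 2) ∧ 0 < y + (K + u j τ₂ ^ 2) := by
    intro y hy
    obtain ⟨s, -, rfl⟩ := hI hy
    constructor <;> positivity
  -- In `Q₂ E₁ - Q₁ E₂` the term `a i s` cancels, so `s` enters only through `y = u i s ^ 2`.
  have hQ := rpow_translates_independent (α := c * Q₂) (β := -(c * Q₁))
    (p := Q₂ * P₁ - Q₁ * P₂) (q := Q₂ * R₁ - Q₁ * R₂) hlh hm hT hpos (by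
      intro y hy
      obtain ⟨s, hs, rfl⟩ := hI hy
      linear_combination Q₂ * E₁ s hs - Q₁ * E₂ s hs)
  have hQ₁ : Q₁ = 0 := by simpa [hc] using hQ.2
  -- With `Q₁ = 0` one translate suffices; the second is a dummy.
  have := rpow_translates_independent (α := c) (β := 0) (p := P₁) (q := R₁) hlh hm hT hpos (by
      intro y hy
      obtain ⟨s, hs, rfl⟩ := hI hy
      have := E₁ s hs
      rw [hQ₁] at this
      linear_combination this)
  exact hc this.1

/-! ### Differential, normal and shape operator of the graph -/

theorem fderiv_euclidean_apply {m k : ℕ} {g : Euc m → Euc k} {x : Euc m}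
    (hg : DifferentiableAt ℝ g x) (v : Euc m) (i : Fin k) :
    fderiv ℝ g x v i = fderiv ℝ (fun y => g y i) x v :=
  DFunLike.congr_fun (((hasFDerivWithinAt_euclidean.1 hg.hasFDerivAt.hasFDerivWithinAt i :
    HasFDerivWithinAt _ _ Set.univ x).hasFDerivAt_of_univ).fderiv.symm) v

theorem hasFDerivAt_coord {m : ℕ} (x : Euc m) (i : Fin m) :
    HasFDerivAt (fun y : Euc m => y i) (EuclideanSpace.proj i : Euc m →L[ℝ] ℝ) x :=
  (EuclideanSpace.proj i : Euc m →L[ℝ] ℝ).hasFDerivAt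

theorem hasFDerivAt_comp_coord {m : ℕ} {x : Euc m} {i : Fin m} {g : ℝ → ℝ} {g' : ℝ}
    (hg : HasDerivAt g g' (x i)) :
    HasFDerivAt (fun y : Euc m => g (y i)) (g' • (EuclideanSpace.proj i : Euc m →L[ℝ] ℝ)) x :=
  hg.comp_hasFDerivAt x (hasFDerivAt_coord x i)

section Graph

variable {n : ℕ} {f : Fin n → ℝ → ℝ} {u : Fin n → ℝ} {x : Euc n}

theorem hasFDerivAt_separableSum (hf : ∀ i, HasDerivAt (f i) (u i) (x i)) :
    HasFDerivAt (separableSum f)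
      (∑ i, u i • (EuclideanSpace.proj i : Euc n →L[ℝ] ℝ)) x := by
  have h := HasFDerivAt.fun_sum (u := univ) fun i _ => hasFDerivAt_comp_coord (hf i)
  exact h

theorem differentiableAt_graphMap {F : Euc n → ℝ} (hF : DifferentiableAt ℝ F x) :
    DifferentiableAt ℝ (graphMap F) x := by
  rw [differentiableAt_euclidean]
  intro k
  cases k using Fin.lastCases with
  | last => simpa [graphMap] using hF
  | cast i => simpa [graphMap] using (hasFDerivAt_coord x i).differentiableAt

theorem fderiv_graphMap_castSucc {F : Euc n → ℝ} (hF : DifferentiableAt ℝ F x) (v : Euc n)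
    (i : Fin n) : fderiv ℝ (graphMap F) x v i.castSucc = v i := by
  rw [fderiv_euclidean_apply (differentiableAt_graphMap hF)]
  simp [graphMap, (hasFDerivAt_coord x i).fderiv]

theorem fderiv_graphMap_last {F : Euc n → ℝ} (hF : DifferentiableAt ℝ F x) (v : Euc n) :
    fderiv ℝ (graphMap F) x v (Fin.last n) = fderiv ℝ F x v := by
  rw [fderiv_euclidean_apply (differentiableAt_graphMap hF)]
  simp [graphMap]

theorem fderiv_graphMap_injective {F : Euc n → ℝ} (hF : DifferentiableAt ℝ F x) :
    Function.Injective (fderiv ℝ (graphMap F) x) := by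
  intro v w h
  ext i
  rw [← fderiv_graphMap_castSucc hF v i, h, fderiv_graphMap_castSucc hF]

end Graph

section Normal

variable {n : ℕ} {Ω : Set (Euc n)} {f : Fin n → ℝ → ℝ} {N : Euc n → Euc (n + 1)}

theorem IsTranslationGraph.isOpen_image (hM : IsTranslationGraph Ω f) (i : Fin n) :
    IsOpen ((fun x : Euc n => x i) '' Ω) :=
  (EuclideanSpace.proj i : Euc n →L[ℝ] ℝ).isOpenMap
    (fun c => ⟨EuclideanSpace.single i c, by simp⟩) Ω hM.isOpen

theorem IsTranslationGraph.contDiffOn_deriv (hM : IsTranslationGraph Ω f) (i : Fin n) :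
    ContDiffOn ℝ ∞ (deriv (f i)) ((fun x : Euc n => x i) '' Ω) :=
  (hM.smooth i).deriv_of_isOpen (hM.isOpen_image i) (by simp)

theorem IsTranslationGraph.hasDerivAt (hM : IsTranslationGraph Ω f) {x : Euc n} (hx : x ∈ Ω)
    (i : Fin n) : HasDerivAt (f i) (deriv (f i) (x i)) (x i) :=
  (((hM.smooth i).contDiffAt ((hM.isOpen_image i).mem_nhds ⟨x, hx, rfl⟩)).differentiableAt
    (by simp)).hasDerivAt

theorem IsTranslationGraph.hasDerivAt_deriv (hM : IsTranslationGraph Ω f) {x : Euc n}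
    (hx : x ∈ Ω) (i : Fin n) :
    HasDerivAt (deriv (f i)) (deriv (deriv (f i)) (x i)) (x i) :=
  (((hM.contDiffOn_deriv i).contDiffAt
    ((hM.isOpen_image i).mem_nhds ⟨x, hx, rfl⟩)).differentiableAt (by simp)).hasDerivAt

theorem IsTranslationGraph.continuousAt_deriv_deriv (hM : IsTranslationGraph Ω f) {x : Euc n}
    (hx : x ∈ Ω) (i : Fin n) : ContinuousAt (deriv (deriv (f i))) (x i) :=
  ((hM.contDiffOn_deriv i).deriv_of_isOpen (m := ∞) (hM.isOpen_image i)
    (by simp)).continuousOn.continuousAt ((hM.isOpen_image i).mem_nhds ⟨x, hx, rfl⟩)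

theorem unitNormal_castSucc (hM : IsTranslationGraph Ω f)
    (hN : IsUnitNormalField Ω (graphMap (separableSum f)) N) {x : Euc n} (hx : x ∈ Ω)
    (i : Fin n) : N x i.castSucc = -(deriv (f i) (x i) * N x (Fin.last n)) := by
  have hF := hasFDerivAt_separableSum (hM.hasDerivAt hx)
  have h := hN.normal x hx (EuclideanSpace.single i 1)
  rw [PiLp.inner_apply, Fin.sum_univ_castSucc] at h
  simp only [fderiv_graphMap_castSucc hF.differentiableAt,
    fderiv_graphMap_last hF.differentiableAt, hF.fderiv] at h
  simp at h
  linarith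

theorem unitNormal_last_sq (hM : IsTranslationGraph Ω f)
    (hN : IsUnitNormalField Ω (graphMap (separableSum f)) N) {x : Euc n} (hx : x ∈ Ω) :
    N x (Fin.last n) ^ 2 * (1 + ∑ i, deriv (f i) (x i) ^ 2) = 1 := by
  have h := hN.norm_eq_one x hx
  have h2 : ‖N x‖ ^ 2 = 1 := by rw [h, one_pow]
  rw [EuclideanSpace.norm_sq_eq, Fin.sum_univ_castSucc] at h2
  simp only [unitNormal_castSucc hM hN hx, Real.norm_eq_abs, sq_abs, neg_sq, mul_pow] at h2
  rw [← sum_mul] at h2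
  linarith

theorem shapeOperator_apply (hM : IsTranslationGraph Ω f)
    (hN : IsUnitNormalField Ω (graphMap (separableSum f)) N) {x : Euc n} (hx : x ∈ Ω)
    (v : Euc n) (i : Fin n) :
    shapeOperator (graphMap (separableSum f)) N x v i =
      N x (Fin.last n) * (deriv (deriv (f i)) (x i) * v i - deriv (f i) (x i) *
        (∑ k, deriv (f k) (x k) * (deriv (deriv (f k)) (x k) * v k)) /
          (1 + ∑ k, deriv (f k) (x k) ^ 2)) := by
  have hF := hasFDerivAt_separableSum (hM.hasDerivAt hx)
  have hNd : DifferentiableAt ℝ N x :=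
    (hN.smooth.contDiffAt (hM.isOpen.mem_nhds hx)).differentiableAt (by simp)
  have hspec := shapeOperator_spec hM.isOpen hN hx (fderiv_graphMap_injective hF.differentiableAt) v
  set w := shapeOperator (graphMap (separableSum f)) N x v
  set t := N x (Fin.last n) with ht
  set τ := fderiv ℝ (fun y => N y (Fin.last n)) x v with hτ
  have hdl : DifferentiableAt ℝ (fun y => N y (Fin.last n)) x := differentiableAt_euclidean.1 hNd _
  -- Differentiating `N_k = -uₖ t` leaves `τ = dt(v)` unknown; the last component `∑ uₖ wₖ = -τ`
  -- then determines it.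
  have hw : ∀ k, w k = deriv (deriv (f k)) (x k) * v k * t + deriv (f k) (x k) * τ := by
    intro k
    have h1 := congrArg (fun z : Euc (n + 1) => z k.castSucc) hspec
    simp only [fderiv_graphMap_castSucc hF.differentiableAt, PiLp.neg_apply,
      fderiv_euclidean_apply hNd] at h1
    have h2 : HasFDerivAt (fun y => N y k.castSucc) _ x :=
      (((hasFDerivAt_comp_coord (hM.hasDerivAt_deriv hx k)).mul
        hdl.hasFDerivAt).neg).congr_of_eventuallyEq (by
          filter_upwards [hM.isOpen.mem_nhds hx] with y hy using unitNormal_castSucc hM hN hy k)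
    rw [h1, h2.fderiv]
    simp [← hτ, ← ht]
    ring
  have hlast := congrArg (fun z : Euc (n + 1) => z (Fin.last n)) hspec
  simp only [fderiv_graphMap_last hF.differentiableAt, PiLp.neg_apply,
    fderiv_euclidean_apply hNd, hF.fderiv] at hlast
  simp only [_root_.sum_apply, smul_apply, PiLp.proj_apply, smul_eq_mul, hw, ← hτ] at hlast
  have hW : (1 + ∑ k, deriv (f k) (x k) ^ 2) ≠ 0 := by positivity
  have hsum : ∑ k, deriv (f k) (x k) *
      (deriv (deriv (f k)) (x k) * v k * t + deriv (f k) (x k) * τ) =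
      t * (∑ k, deriv (f k) (x k) * (deriv (deriv (f k)) (x k) * v k)) +
        τ * ∑ k, deriv (f k) (x k) ^ 2 := by
    rw [mul_sum, mul_sum, ← sum_add_distrib]
    exact sum_congr rfl fun k _ => by ring
  have hτ' : τ = -(t * (∑ k, deriv (f k) (x k) * (deriv (deriv (f k)) (x k) * v k)) /
      (1 + ∑ k, deriv (f k) (x k) ^ 2)) := by
    rw [← neg_div, eq_div_iff hW]
    linarith
  rw [hw, hτ']
  ring

theorem Scurv_eq (hM : IsTranslationGraph Ω f)
    (hN : IsUnitNormalField Ω (graphMap (separableSum f)) N) {r : ℕ} (hr : r ≤ n) {x : Euc n}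
    (hx : x ∈ Ω) :
    Scurv r (graphMap (separableSum f)) N x =
      N x (Fin.last n) ^ r * curvPoly r (fun i => deriv (deriv (f i)) (x i))
        (fun i => deriv (f i) (x i) ^ 2) / (1 + ∑ i, deriv (f i) (x i) ^ 2) := by
  rw [Scurv, ← LinearMap.charpoly_toMatrix _ (EuclideanSpace.basisFun (Fin n) ℝ).toBasis]
  refine charpoly_coeff_rank_one_perturbation hr _ (fun i => deriv (f i) (x i)) _ _ fun i j => ?_
  rw [LinearMap.toMatrix_apply]
  rcases eq_or_ne i j with rfl | hij
  · simp [shapeOperator_apply hM hN hx]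
  · simp [shapeOperator_apply hM hN hx, hij]

/-- The product squares to 1 and `N_last` is continuous and nonzero. The sign is only local, since
`Ω` need not be connected. -/
theorem unitNormal_last_sign (hM : IsTranslationGraph Ω f)
    (hN : IsUnitNormalField Ω (graphMap (separableSum f)) N) {x : Euc n} (hx : x ∈ Ω) :
    ∃ ε : ℝ, ε ^ 2 = 1 ∧ ∀ᶠ y in 𝓝 x,
      N y (Fin.last n) * √(1 + ∑ i, deriv (f i) (y i) ^ 2) = ε := by
  have hcont : ContinuousAt (fun y => N y (Fin.last n)) x :=
    (differentiableAt_euclidean.1 ((hN.smooth.contDiffAt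
      (hM.isOpen.mem_nhds hx)).differentiableAt (by simp)) _).continuousAt
  have hne : N x (Fin.last n) ≠ 0 := by
    intro h
    simpa [h] using unitNormal_last_sq hM hN hx
  have hsq : ∀ y ∈ Ω, (N y (Fin.last n) * √(1 + ∑ i, deriv (f i) (y i) ^ 2)) ^ 2 = 1 := by
    intro y hy
    rw [mul_pow, Real.sq_sqrt (by positivity), unitNormal_last_sq hM hN hy]
  rcases hne.lt_or_gt with hlt | hgt
  · refine ⟨-1, by norm_num, ?_⟩
    filter_upwards [hM.isOpen.mem_nhds hx, hcont.eventually_lt_const hlt] with y hy hneg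
    have h1 : 0 < √(1 + ∑ i, deriv (f i) (y i) ^ 2) := Real.sqrt_pos.2 (by positivity)
    rcases eq_or_eq_neg_of_sq_eq_sq _ 1 ((hsq y hy).trans (one_pow 2).symm) with h | h
    · nlinarith
    · exact h
  · refine ⟨1, by norm_num, ?_⟩
    filter_upwards [hM.isOpen.mem_nhds hx, hcont.eventually_const_lt hgt] with y hy hpos
    have h1 : 0 < √(1 + ∑ i, deriv (f i) (y i) ^ 2) := Real.sqrt_pos.2 (by positivity)
    rcases eq_or_eq_neg_of_sq_eq_sq _ 1 ((hsq y hy).trans (one_pow 2).symm) with h | h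
    · exact h
    · nlinarith

end Normal

end TranslationHypersurface

/-! ### Conclusion -/

open Filter Topology TranslationHypersurface in
theorem theorem2 (n r : ℕ) (hn : 3 ≤ n) (hr : 2 < r) (hrn : r < n)
    (Ω : Set (TranslationHypersurface.Euc n)) (f : Fin n → ℝ → ℝ)
    (hM : TranslationHypersurface.IsTranslationGraph Ω f)
    (N : TranslationHypersurface.Euc n → TranslationHypersurface.Euc (n + 1))
    (hN : TranslationHypersurface.IsUnitNormalField Ω
      (TranslationHypersurface.graphMap (TranslationHypersurface.separableSum f)) N)
    (hconst : ∃ c : ℝ, ∀ x ∈ Ω,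
      TranslationHypersurface.Scurv r
        (TranslationHypersurface.graphMap (TranslationHypersurface.separableSum f)) N x = c) :
    ∀ x ∈ Ω,
      TranslationHypersurface.Scurv r
        (TranslationHypersurface.graphMap (TranslationHypersurface.separableSum f)) N x = 0 := by
  obtain ⟨c, hc⟩ := hconst
  intro x hx
  rw [hc x hx]
  obtain ⟨ε, hε, hsign⟩ := unitNormal_last_sign hM hN hx
  have hεr : ε ^ r * ε ^ r = 1 := by rw [← pow_add, ← two_mul, pow_mul, hε, one_pow]
  have key : ε ^ r * c = 0 := by
    -- In powers of `W²`, `r / 2` comes from `N_last ^ r` and `1` from the denominator in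
    -- `Scurv_eq`.
    have hm : (2 : ℝ) < ((r : ℝ) + 2) / 2 := by
      have : (2 : ℝ) < r := by exact_mod_cast hr
      linarith
    refine const_eq_zero_of_curvPoly_eq hr.le hm (u := fun i => deriv (f i))
      (a := fun i => deriv (deriv (f i))) (x₀ := x) (fun i => ?_) (fun i => ?_) ?_
    · filter_upwards [(hM.isOpen_image i).mem_nhds ⟨x, hx, rfl⟩] with s hs
      obtain ⟨y, hy, rfl⟩ := hs
      exact hM.hasDerivAt_deriv hy i
    · exact hM.continuousAt_deriv_deriv hx i
    · filter_upwards [hM.isOpen.mem_nhds hx, hsign] with y hy hs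
      have hcy := hc y hy
      rw [Scurv_eq hM hN hrn.le hy] at hcy
      have hWpos : 0 < 1 + ∑ i, deriv (f i) (y i) ^ 2 := by positivity
      set W := 1 + ∑ i, deriv (f i) (y i) ^ 2
      have hpow : W ^ (((r : ℝ) + 2) / 2) = √W ^ r * W := by
        rw [Real.sqrt_eq_rpow, ← Real.rpow_mul_natCast hWpos.le, ← Real.rpow_add_one hWpos.ne']
        congr 1
        ring
      rw [div_eq_iff hWpos.ne'] at hcy
      rw [hpow, ← one_mul (curvPoly _ _ _), ← hεr]
      nth_rewrite 2 [← hs]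
      rw [mul_pow]
      linear_combination ε ^ r * √W ^ r * hcy
  linear_combination ε ^ r * key - c * hεr
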